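/- Let $d\in\mathbb N$ and let $X_1,X_2,\dots$ be independent and identically distributed random vectors in $\mathbb R^d$ on a probability space $(\Omega,\mathcal A,\mathbb P)$ with $\mathbb E[X_1]=0$ and $\mathbb E[\|X_1\|^2]<\infty$, where $\|\cdot\|$ is the Euclidean norm. For $n\ge 1$ put $\overline X_n=\frac1n\sum_{i=1}^n X_i$ and $V_n=n\|\overline X_n\|^2$. Let $(\Omega^*,\mathcal A^*,\mathbb P^*)$ be a probability space and, for every $n\ge1$, let $i_{n1},\dots,i_{nn}$ be random variables on it that are independent and uniformly distributed on $\{1,\dots,n\}$. For $\omega\in\Omega$ and $\omega^*\in\Omega^*$ put $\xi_{nk}(\omega)(\omega^*)=X_{i_{nk}(\omega^*)}(\omega)$ for $1\le k\le n$, $\overline\xi_n(\omega)=\frac1n\sum_{k=1}^n\bigl(\xi_{nk}(\omega)-\overline X_n(\omega)\bigr)$, and $V_n^*(\omega)=n\|\overline\xi_n(\omega)\|^2$, which for each fixed $\omega$ is a random variable on $\Omega^*$. Then, for $\mathbb P$-almost every $\omega\in\Omega$, $$\sup_{x\in\mathbb R}\bigl|\mathbb P^*(V_n^*(\omega)\le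 x)-\mathbb P(V_n\le x)\bigr|\longrightarrow 0\qquad (n\to\infty).$$ -/

import Mathlib

open MeasureTheory ProbabilityTheory Filter Topology
open scoped ENNReal

namespace BootstrapMean

/-- The arithmetic mean of the first `n` observations. The observations `X 0, X 1, …` are indexed
from `0`, so the first `n` of them are `X 0, …, X (n - 1)`. -/
noncomputable def sampleMean {Ω : Type*} {d : ℕ} (X : ℕ → Ω → EuclideanSpace ℝ (Fin d))
    (n : ℕ) (ω : Ω) : EuclideanSpace ℝ (Fin d) :=
  (n : ℝ)⁻¹ • ∑ i ∈ Finset.range n, X i ω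

/-- The test statistic `n * ‖sample mean‖ ^ 2`, with the Euclidean norm. -/
noncomputable def testStat {Ω : Type*} {d : ℕ} (X : ℕ → Ω → EuclideanSpace ℝ (Fin d))
    (n : ℕ) (ω : Ω) : ℝ :=
  n * ‖sampleMean X n ω‖ ^ 2

/-- Efron's resampling indices: for every `n`, the `n` random variables `I n k` with values in the
`n`-element set `Fin n = {0, …, n - 1}` are independent and each is uniformly distributed.
No relation between different values of `n` is required. -/
structure IsResampling {Ω' : Type*} [MeasurableSpace Ω'] (P' : Measure Ω')
    (I : (n : ℕ) → Fin n → Ω' → Fin n) : Prop where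
  measurable : ∀ n k, Measurable (I n k)
  indep : ∀ n, iIndepFun (I n) P'
  uniform : ∀ (n : ℕ) (k j : Fin n), P' {ω' | I n k ω' = j} = (n : ℝ≥0∞)⁻¹

/-- The `k`-th bootstrap observation, at a fixed sample point `ω`: the observation whose index was
drawn. -/
def bootSample {Ω Ω' : Type*} {d : ℕ} (X : ℕ → Ω → EuclideanSpace ℝ (Fin d))
    (I : (n : ℕ) → Fin n → Ω' → Fin n) (n : ℕ) (k : Fin n) (ω : Ω) (ω' : Ω') :
    EuclideanSpace ℝ (Fin d) :=
  X (I n k ω') ω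

/-- The arithmetic mean of the bootstrap observations centered at the sample mean. -/
noncomputable def bootMean {Ω Ω' : Type*} {d : ℕ} (X : ℕ → Ω → EuclideanSpace ℝ (Fin d))
    (I : (n : ℕ) → Fin n → Ω' → Fin n) (n : ℕ) (ω : Ω) (ω' : Ω') :
    EuclideanSpace ℝ (Fin d) :=
  (n : ℝ)⁻¹ • ∑ k : Fin n, (bootSample X I n k ω ω' - sampleMean X n ω)

/-- The bootstrap version of the test statistic; for fixed `ω` it is a random variable on `Ω'`. -/
noncomputable def bootStat {Ω Ω' : Type*} {d : ℕ} (X : ℕ → Ω → EuclideanSpace ℝ (Fin d))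
    (I : (n : ℕ) → Fin n → Ω' → Fin n) (n : ℕ) (ω : Ω) (ω' : Ω') : ℝ :=
  n * ‖bootMean X I n ω ω'‖ ^ 2

end BootstrapMean

/-! Both statistics are squared norms: of n^{-1/2} ∑ X_i, and of its bootstrap analogue built from n
independent draws from the centered empirical measure. For almost every ω both vectors converge in
law to the same centered Gaussian, with the covariance of X_1. For the first this is the central
limit theorem. The second has as characteristic function the n-th power of an explicit average
(`charFun_map_sum_comp_uniform`), whose limit needs only convergence of the first two empirical
moments (`tendsto_empirical_charFun_pow`); the strong law supplies that.

If the covariance is nonzero, the Gaussian does not charge spheres, so the limiting distribution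
function is continuous and Pólya's theorem makes both convergences uniform
(`tendsto_iSup_abs_sub_of_tendsto`). If it is zero, the limiting distribution function jumps at 0,
but then all X_i vanish almost surely and the two distribution functions coincide. -/

namespace BootstrapMean

/-! ### Characteristic functions of empirical measures -/

lemma tendsto_div_self_of_tendsto_average {a : ℕ → ℝ} {q : ℝ}
    (h : Tendsto (fun n : ℕ => (n : ℝ)⁻¹ * ∑ j ∈ Finset.range n, a j) atTop (𝓝 q)) :
    Tendsto (fun n : ℕ => a n / n) atTop (𝓝 0) := by
  have h1 : Tendsto (fun n : ℕ => (1 + (n : ℝ)⁻¹) *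
      (((n + 1 : ℕ) : ℝ)⁻¹ * ∑ j ∈ Finset.range (n + 1), a j)
      - (n : ℝ)⁻¹ * ∑ j ∈ Finset.range n, a j) atTop (𝓝 ((1 + 0) * q - q)) :=
    (((tendsto_const_nhds (x := (1 : ℝ))).add tendsto_inv_atTop_nhds_zero_nat).mul
      ((tendsto_add_atTop_iff_nat 1).2 h)).sub h
  rw [add_zero, one_mul, sub_self] at h1
  refine h1.congr' ?_
  filter_upwards [eventually_gt_atTop 0] with n hn
  have : (n : ℝ) ≠ 0 := by positivity
  rw [Finset.sum_range_succ]
  push_cast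
  field_simp
  ring

/-- Lindeberg-type negligibility. Convergent averages force y_j² / j → 0, which handles large j; the
finitely many remaining terms are bounded by a constant, which ε√n eventually exceeds. -/
lemma eventually_forall_abs_le_sqrt {y : ℕ → ℝ} {q : ℝ}
    (h : Tendsto (fun n : ℕ => (n : ℝ)⁻¹ * ∑ j ∈ Finset.range n, y j ^ 2) atTop (𝓝 q))
    {ε : ℝ} (hε : 0 < ε) :
    ∀ᶠ n : ℕ in atTop, ∀ j < n, |y j| ≤ ε * √n := by
  have h0 := tendsto_div_self_of_tendsto_average h
  have h1 : ∀ᶠ j : ℕ in atTop, |y j| ≤ ε * √j := by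
    filter_upwards [h0.eventually_le_const (show 0 < ε ^ 2 by positivity), eventually_gt_atTop 0]
      with j hj hj0
    rw [div_le_iff₀ (by positivity)] at hj
    rw [← Real.sqrt_sq hε.le, ← Real.sqrt_mul (by positivity), ← Real.sqrt_sq_eq_abs]
    exact Real.sqrt_le_sqrt hj
  obtain ⟨N, hN⟩ := eventually_atTop.1 h1
  have h2 : ∀ᶠ n : ℕ in atTop, ∑ j ∈ Finset.range N, |y j| ≤ ε * √n :=
    ((Real.tendsto_sqrt_atTop.comp tendsto_natCast_atTop_atTop).const_mul_atTop hε
      ).eventually_ge_atTop _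
  filter_upwards [h2] with n hn j hj
  rcases le_or_gt N j with hNj | hNj
  · exact (hN j hNj).trans (by gcongr)
  · exact (Finset.single_le_sum (f := fun j => |y j|) (fun _ _ => abs_nonneg _)
      (Finset.mem_range.2 hNj)).trans hn

lemma norm_cexp_mul_I_sub_taylor_two_le {u : ℝ} (hu : |u| ≤ 1) :
    ‖Complex.exp (u * Complex.I) - 1 - u * Complex.I + (u ^ 2 / 2 : ℝ)‖ ≤ |u| ^ 3 := by
  have hn : ‖(u * Complex.I : ℂ)‖ = |u| := by simp
  have h := Complex.exp_bound (x := u * Complex.I) (by rwa [hn]) (n := 3) (by norm_num)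
  rw [hn] at h
  refine le_trans (le_of_eq ?_) (h.trans ?_)
  · congr 1
    simp [Finset.sum_range_succ, mul_pow, Nat.factorial]
    ring
  · have : (0 : ℝ) ≤ |u| ^ 3 := by positivity
    norm_num [Nat.factorial]
    linarith

/-- The characteristic functions of the centered and normalized empirical measures converge to the
Gaussian one as soon as the first two empirical moments converge. -/
lemma tendsto_empirical_charFun_pow {y : ℕ → ℝ} {q : ℝ}
    (h1 : Tendsto (fun n : ℕ => (n : ℝ)⁻¹ * ∑ j ∈ Finset.range n, y j) atTop (𝓝 0))
    (h2 : Tendsto (fun n : ℕ => (n : ℝ)⁻¹ * ∑ j ∈ Finset.range n, y j ^ 2) atTop (𝓝 q)) :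
    Tendsto (fun n : ℕ => ((n : ℂ)⁻¹ * ∑ j ∈ Finset.range n, Complex.exp
      (((√n)⁻¹ * (y j - (n : ℝ)⁻¹ * ∑ j ∈ Finset.range n, y j) : ℝ) * Complex.I)) ^ n)
      atTop (𝓝 (Complex.exp (-q / 2))) := by
  set m : ℕ → ℝ := fun n => (n : ℝ)⁻¹ * ∑ j ∈ Finset.range n, y j with hm
  set v : ℕ → ℝ := fun n => (n : ℝ)⁻¹ * ∑ j ∈ Finset.range n, (y j - m n) ^ 2 with hv
  have hsum : ∀ n : ℕ, 0 < n → ∑ j ∈ Finset.range n, y j = n * m n := fun n hn => by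
    rw [hm]; field_simp
  have hv_tendsto : Tendsto v atTop (𝓝 q) := by
    have h3 := h2.sub (h1.pow 2)
    rw [zero_pow two_ne_zero, sub_zero] at h3
    refine h3.congr' ?_
    filter_upwards [eventually_gt_atTop 0] with n hn
    have hn' : (n : ℝ) ≠ 0 := by positivity
    have : ∑ j ∈ Finset.range n, (y j - m n) ^ 2
        = ∑ j ∈ Finset.range n, y j ^ 2 - n * m n ^ 2 := by
      simp_rw [sub_sq, Finset.sum_add_distrib, Finset.sum_sub_distrib, ← Finset.sum_mul,
        ← Finset.mul_sum, hsum n hn]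
      simp
      ring
    simp only [hv, this]
    change _ - m n ^ 2 = _
    field_simp
  have hsmall : ∀ δ : ℝ, 0 < δ → ∀ᶠ n : ℕ in atTop, ∀ j < n, |y j - m n| ≤ δ * √n := by
    intro δ hδ
    filter_upwards [eventually_forall_abs_le_sqrt h2 (half_pos hδ), eventually_ge_atTop 1,
      h1.abs.eventually_le_const (show |(0 : ℝ)| < δ / 2 by simpa using half_pos hδ)]
      with n hn hn1 hmn j hj
    have : 1 ≤ √(n : ℝ) := Real.one_le_sqrt.2 (by exact_mod_cast hn1)
    calc |y j - m n| ≤ |y j| + |m n| := abs_sub _ _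
      _ ≤ δ / 2 * √n + δ / 2 * √n := add_le_add (hn j hj) (hmn.trans (by nlinarith))
      _ = δ * √n := by ring
  -- The average is 1 + z_n with n z_n → -q/2, so its n-th power tends to exp(-q/2).
  suffices h : Tendsto (fun n : ℕ => (n : ℂ) * ((n : ℂ)⁻¹ * ∑ j ∈ Finset.range n, Complex.exp
      (((√n)⁻¹ * (y j - m n) : ℝ) * Complex.I) - 1)) atTop (𝓝 (-q / 2)) by
    refine (Complex.tendsto_one_add_pow_exp_of_tendsto h).congr fun n => ?_
    rw [add_sub_cancel]
  have hv' : Tendsto (fun n => ((-v n / 2 : ℝ) : ℂ)) atTop (𝓝 (-q / 2)) := by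
    have := (Complex.continuous_ofReal.tendsto _).comp (hv_tendsto.neg.div_const 2)
    simpa [Function.comp_def] using this
  have hq : 0 ≤ q := ge_of_tendsto' h2 fun n => by positivity
  refine tendsto_of_tendsto_of_dist hv' (Metric.tendsto_nhds.2 fun ε hε => ?_)
  -- The bound 1 allows the Taylor estimate; ε / (q + 2) makes the total error δ (q + 1) less than
  -- ε.
  have hδ : 0 < min 1 (ε / (q + 2)) := by positivity
  filter_upwards [hsmall _ hδ, eventually_gt_atTop 0,
    hv_tendsto.eventually_le_const (show q < q + 1 by linarith)] with n hn hn0 hvn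
  have hn' : (0 : ℝ) < n := by exact_mod_cast hn0
  have hsn : 0 < √(n : ℝ) := Real.sqrt_pos.2 hn'
  set δ := min 1 (ε / (q + 2))
  set u : ℕ → ℝ := fun j => (√n)⁻¹ * (y j - m n) with hu
  have hu_le : ∀ j < n, |u j| ≤ δ := fun j hj => by
    rw [hu, abs_mul, abs_of_pos (inv_pos.2 hsn), inv_mul_le_iff₀ hsn, mul_comm]
    exact hn j hj
  have hu_sum : ∑ j ∈ Finset.range n, u j = 0 := by
    simp only [hu, ← Finset.mul_sum, Finset.sum_sub_distrib, hsum n hn0]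
    simp
  have hu_sq : ∑ j ∈ Finset.range n, u j ^ 2 = v n := by
    simp only [hu, hv, mul_pow, ← Finset.mul_sum, inv_pow, Real.sq_sqrt hn'.le]
  -- Centering cancels the linear terms and the quadratic terms add up to the empirical variance, so
  -- only Taylor remainders are left.
  have hkey : (n : ℂ) * ((n : ℂ)⁻¹ * ∑ j ∈ Finset.range n, Complex.exp (u j * Complex.I) - 1)
      - ((-v n / 2 : ℝ) : ℂ) = ∑ j ∈ Finset.range n,
        (Complex.exp (u j * Complex.I) - 1 - u j * Complex.I + (u j ^ 2 / 2 : ℝ)) := by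
    rw [Finset.sum_add_distrib, Finset.sum_sub_distrib, Finset.sum_sub_distrib, ← Finset.sum_mul,
      ← Complex.ofReal_sum, ← Complex.ofReal_sum, hu_sum, ← Finset.sum_div, hu_sq, mul_sub,
      mul_inv_cancel_left₀ (by exact_mod_cast hn'.ne')]
    simp
    ring
  rw [dist_zero_right, Real.norm_of_nonneg dist_nonneg, dist_comm, dist_eq_norm, hkey]
  calc _ ≤ ∑ j ∈ Finset.range n, δ * u j ^ 2 := norm_sum_le_of_le _ fun j hj => by
        have hj' := hu_le j (Finset.mem_range.1 hj)
        refine (norm_cexp_mul_I_sub_taylor_two_le (hj'.trans (min_le_left _ _))).trans ?_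
        rw [pow_succ', ← sq_abs (u j)]
        gcongr
    _ = δ * v n := by rw [← Finset.mul_sum, hu_sq]
    _ ≤ ε / (q + 2) * (q + 1) := by
        gcongr
        exact min_le_right _ _
    _ < ε := by
        rw [div_mul_eq_mul_div, div_lt_iff₀ (by positivity)]
        nlinarith

/-! ### Uniform convergence of distribution functions -/

lemma continuous_cdf (μ : Measure ℝ) [IsProbabilityMeasure μ] [NullSingletonClass μ] :
    Continuous (cdf μ) := by
  refine continuous_iff_continuousAt.2 fun x => continuousAt_iff_continuous_left'_right'.2
    ⟨(cdf μ).mono.continuousWithinAt_Iio_iff_leftLim_eq.2 ?_, ((cdf μ).right_continuous x).mono Set.Ioi_subset_Ici_self⟩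
  have h := (cdf μ).measure_singleton x
  rw [measure_cdf, measure_singleton, eq_comm, ENNReal.ofReal_eq_zero, sub_nonpos] at h
  exact le_antisymm ((cdf μ).mono.leftLim_le le_rfl) h

/-- **Pólya's theorem**: pointwise convergence of distribution functions to a continuous
distribution function is uniform. -/
lemma tendstoUniformly_of_monotone {F : ℕ → ℝ → ℝ} {G : ℝ → ℝ} (hF : ∀ n, Monotone (F n))
    (hF0 : ∀ n x, 0 ≤ F n x) (hF1 : ∀ n x, F n x ≤ 1)
    (hG : Monotone G) (hGc : Continuous G) (hbot : Tendsto G atBot (𝓝 0))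
    (htop : Tendsto G atTop (𝓝 1)) (h : ∀ x, Tendsto (fun n => F n x) atTop (𝓝 (G x))) :
    TendstoUniformly F G atTop := by
  have hG0 : ∀ x, 0 ≤ G x := fun x => ge_of_tendsto' (h x) fun n => hF0 n x
  have hG1 : ∀ x, G x ≤ 1 := fun x => le_of_tendsto' (h x) fun n => hF1 n x
  rw [Metric.tendstoUniformly_iff]
  intro ε hε
  obtain ⟨a, ha⟩ := (hbot.eventually_lt_const (half_pos hε)).exists
  obtain ⟨b, hb⟩ := (htop.eventually_const_lt (show 1 - ε / 2 < 1 by linarith)).exists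
  have hmid : ∀ᶠ n in atTop, ∀ x ∈ Set.Icc a b, dist (G x) (F n x) < ε := by
    have : TendstoLocallyUniformlyOn F G atTop (Set.Icc a b) := by
      rw [Metric.tendstoLocallyUniformlyOn_iff]
      intro ε hε x _
      -- Near x, monotonicity traps both functions between their values at x ± δ/2, where pointwise
      -- convergence applies.
      have hx := Metric.continuous_iff.1 hGc x (ε / 2) (half_pos hε)
      obtain ⟨δ, hδ, hx⟩ := hx
      have hl : |x - δ / 2 - x| < δ := by
        rw [abs_lt]; constructor <;> linarith
      have hr : |x + δ / 2 - x| < δ := by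
        rw [abs_lt]; constructor <;> linarith
      have hl := abs_lt.1 (hx (x - δ / 2) hl)
      have hr := abs_lt.1 (hx (x + δ / 2) hr)
      refine ⟨Set.Icc (x - δ / 2) (x + δ / 2),
        mem_nhdsWithin_of_mem_nhds (Icc_mem_nhds (by linarith) (by linarith)), ?_⟩
      have e1 := (h (x - δ / 2)).eventually_const_lt (show G x - ε / 2 < _ by linarith)
      have e2 := (h (x + δ / 2)).eventually_lt_const (show _ < G x + ε / 2 by linarith)
      filter_upwards [e1, e2] with n h1 h2 z hz
      rw [Real.dist_eq, abs_lt]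
      have := hF n hz.1
      have := hF n hz.2
      have := hG hz.1
      have := hG hz.2
      constructor <;> linarith
    have := (tendstoLocallyUniformlyOn_iff_tendstoUniformlyOn_of_compact isCompact_Icc).1 this
    exact Metric.tendstoUniformlyOn_iff.1 this ε hε
  filter_upwards [hmid, (h a).eventually_lt_const ha, (h b).eventually_const_lt hb]
    with n hn hna hnb x
  -- In the left tail both values lie in [0, ε/2), in the right tail in (1 - ε/2, 1].
  by_cases hxa : x < a
  · have := hF n hxa.le
    have := hG hxa.le
    have := hF0 n x
    have := hG0 x
    rw [Real.dist_eq, abs_lt]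
    constructor <;> linarith
  by_cases hxb : b < x
  · have := hF n hxb.le
    have := hG hxb.le
    have := hF1 n x
    have := hG1 x
    rw [Real.dist_eq, abs_lt]
    constructor <;> linarith
  exact hn x ⟨not_lt.1 hxa, not_lt.1 hxb⟩

lemma tendsto_iSup_abs_sub_of_tendstoUniformly {F F' : ℕ → ℝ → ℝ} {G : ℝ → ℝ}
    (h : TendstoUniformly F G atTop) (h' : TendstoUniformly F' G atTop) :
    Tendsto (fun n => ⨆ x, |F n x - F' n x|) atTop (𝓝 0) := by
  rw [Metric.tendsto_nhds]
  intro ε hε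
  filter_upwards [Metric.tendstoUniformly_iff.1 h (ε / 3) (by positivity),
    Metric.tendstoUniformly_iff.1 h' (ε / 3) (by positivity)] with n h1 h2
  rw [Real.dist_0_eq_abs, abs_of_nonneg (Real.iSup_nonneg fun _ => abs_nonneg _)]
  refine (Real.iSup_le (a := ε / 3 + ε / 3) (fun x => ?_) (by positivity)).trans_lt (by linarith)
  rw [← Real.dist_eq]
  exact (dist_triangle_left _ _ (G x)).trans (add_le_add (h1 x).le (h2 x).le)

/-- If two sequences of random vectors converge in law to the same limit, which does not charge
spheres around the origin, then the distribution functions of their squared norms merge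
uniformly. -/
lemma tendsto_iSup_abs_sub_of_tendsto {E : Type*} [NormedAddCommGroup E] [MeasurableSpace E]
    [BorelSpace E] {μ ν : ℕ → ProbabilityMeasure E} {ρ : ProbabilityMeasure E}
    (hμ : Tendsto μ atTop (𝓝 ρ)) (hν : Tendsto ν atTop (𝓝 ρ))
    (hρ : ∀ c : ℝ, (ρ : Measure E) {x | ‖x‖ ^ 2 = c} = 0) :
    Tendsto (fun n => ⨆ x : ℝ, |(μ n : Measure E).real {w | ‖w‖ ^ 2 ≤ x}
      - (ν n : Measure E).real {w | ‖w‖ ^ 2 ≤ x}|) atTop (𝓝 0) := by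
  have hms : Measurable fun w : E => ‖w‖ ^ 2 := by fun_prop
  have hcdf : ∀ (π : ProbabilityMeasure E) (x : ℝ),
      (π : Measure E).real {w | ‖w‖ ^ 2 ≤ x} = cdf ((π : Measure E).map fun w => ‖w‖ ^ 2) x := by
    intro π x
    have : IsProbabilityMeasure ((π : Measure E).map fun w => ‖w‖ ^ 2) :=
      Measure.isProbabilityMeasure_map hms.aemeasurable
    rw [cdf_eq_real, map_measureReal_apply hms measurableSet_Iic]
    rfl
  have hpt : ∀ π : ℕ → ProbabilityMeasure E, Tendsto π atTop (𝓝 ρ) → ∀ x : ℝ,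
      Tendsto (fun n => (π n : Measure E).real {w | ‖w‖ ^ 2 ≤ x}) atTop
        (𝓝 ((ρ : Measure E).real {w | ‖w‖ ^ 2 ≤ x})) := by
    intro π hπ x
    refine (ENNReal.tendsto_toReal (measure_ne_top _ _)).comp
      (ProbabilityMeasure.tendsto_measure_of_null_frontier_of_tendsto' hπ ?_)
    -- The boundary of the ball lies in a sphere, which is null for the limit.
    exact measure_mono_null (frontier_le_subset_eq (by fun_prop) continuous_const) (hρ x)
  simp_rw [hcdf] at hpt ⊢
  have : IsProbabilityMeasure ((ρ : Measure E).map fun w => ‖w‖ ^ 2) :=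
      Measure.isProbabilityMeasure_map hms.aemeasurable
  have hcont : Continuous (cdf ((ρ : Measure E).map fun w => ‖w‖ ^ 2)) := by
    have : NullSingletonClass ((ρ : Measure E).map fun w => ‖w‖ ^ 2) := ⟨fun c => by
      rw [Measure.map_apply hms (measurableSet_singleton c)]
      exact hρ c⟩
    exact continuous_cdf _
  exact tendsto_iSup_abs_sub_of_tendstoUniformly
    (tendstoUniformly_of_monotone (fun n => monotone_cdf _) (fun n => cdf_nonneg _)
      (fun n => cdf_le_one _) (monotone_cdf _) hcont (tendsto_cdf_atBot _) (tendsto_cdf_atTop _)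
      (hpt μ hμ))
    (tendstoUniformly_of_monotone (fun n => monotone_cdf _) (fun n => cdf_nonneg _)
      (fun n => cdf_le_one _) (monotone_cdf _) hcont (tendsto_cdf_atBot _) (tendsto_cdf_atTop _)
      (hpt ν hν))

/-! ### Gaussian measure of spheres -/

section GaussianLimit

open scoped Matrix MatrixOrder

variable {d : ℕ}

/-- The standard Gaussian measure is the law of a Gaussian vector plus an independent Gaussian
multiple of a given coordinate vector. -/
lemma stdGaussian_eq_conv (i : Fin d) :
    ∃ ν : Measure (EuclideanSpace ℝ (Fin d)), IsProbabilityMeasure ν ∧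
      stdGaussian (EuclideanSpace ℝ (Fin d)) =
        ν ∗ (gaussianReal 0 1).map (fun z => z • EuclideanSpace.single i (1 : ℝ)) := by
  have hD : (Matrix.diagonal fun j : Fin d => if j = i then (0 : ℝ) else 1).PosSemidef :=
    .diagonal fun j => by dsimp only; split_ifs <;> simp
  have hm : Measurable fun z : ℝ => z • EuclideanSpace.single i (1 : ℝ) := by fun_prop
  -- The covariance is the identity with its i-th diagonal entry removed; the second factor restores
  -- it.
  refine ⟨multivariateGaussian 0 (.diagonal fun j => if j = i then 0 else 1), inferInstance, ?_⟩
  have := Measure.isProbabilityMeasure_map (μ := gaussianReal 0 1) hm.aemeasurable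
  refine Measure.ext_of_charFun (funext fun t => ?_)
  have h1 : charFun ((gaussianReal 0 1).map fun z => z • EuclideanSpace.single i (1 : ℝ)) t
      = Complex.exp (-(t i) ^ 2 / 2) := by
    have h := charFun_gaussianReal (μ := 0) (v := 1) (t := t i)
    rw [charFun_apply_real] at h
    rw [charFun_apply, integral_map hm.aemeasurable (by fun_prop)]
    simp only [real_inner_smul_left, EuclideanSpace.inner_single_left]
    simp [mul_comm] at h ⊢
    rw [h]
    congr 1
    ring
  rw [charFun_conv, charFun_stdGaussian, charFun_multivariateGaussian hD, h1, ← Complex.exp_add]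
  congr 1
  have h2 : ‖t‖ ^ 2 = t ⬝ᵥ ((Matrix.diagonal fun j : Fin d => if j = i then (0 : ℝ) else 1) *ᵥ t)
      + t i ^ 2 := by
    rw [EuclideanSpace.real_norm_sq_eq, ← Finset.add_sum_erase _ _ (Finset.mem_univ i)]
    simp only [Matrix.mulVec_diagonal, dotProduct]
    rw [← Finset.add_sum_erase _ _ (Finset.mem_univ i), add_comm]
    simp only [if_true, zero_mul, mul_zero, zero_add]
    congr 1
    refine Finset.sum_congr rfl fun j hj => ?_
    rw [if_neg (Finset.ne_of_mem_erase hj)]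
    ring
  have h3 : ((‖t‖ : ℂ)) ^ 2 = ((‖t‖ ^ 2 : ℝ) : ℂ) := by push_cast; rfl
  rw [h3, h2]
  simp
  ring

/-- Expanding the square gives a quadratic polynomial in z with leading coefficient ‖w‖² ≠ 0. -/
lemma finite_setOf_norm_add_smul_sq_eq {E : Type*} [NormedAddCommGroup E] [InnerProductSpace ℝ E]
    (y : E) {w : E} (hw : w ≠ 0) (c : ℝ) : {z : ℝ | ‖y + z • w‖ ^ 2 = c}.Finite := by
  open Polynomial in
  let p : ℝ[X] := C (‖w‖ ^ 2) * X ^ 2 + C (2 * inner ℝ y w) * X + C (‖y‖ ^ 2 - c)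
  have hp : p ≠ 0 := by
    intro h
    have := congrArg Polynomial.natDegree h
    rw [Polynomial.natDegree_quadratic (by simpa using hw)] at this
    simp at this
  refine (p.roots.toFinset.finite_toSet).subset fun z hz => ?_
  simp only [Finset.mem_coe, Multiset.mem_toFinset, Polynomial.mem_roots hp, Polynomial.IsRoot.def]
  have hz' : ‖y + z • w‖ ^ 2 = c := hz
  rw [norm_add_sq_real, inner_smul_right, norm_smul, mul_pow, Real.norm_eq_abs, sq_abs] at hz'
  simp [p]
  linarith

/-- A Gaussian measure which is not a Dirac mass does not charge spheres around the origin. -/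
lemma multivariateGaussian_norm_sq_eq_null {S : Matrix (Fin d) (Fin d) ℝ} (hS : S.PosSemidef)
    (hS0 : ∃ t : EuclideanSpace ℝ (Fin d), t ⬝ᵥ S *ᵥ t ≠ 0) (c : ℝ) :
    multivariateGaussian 0 S {x | ‖x‖ ^ 2 = c} = 0 := by
  obtain ⟨t, ht⟩ := hS0
  set A := Matrix.toEuclideanCLM (𝕜 := ℝ) (CFC.sqrt S) with hA
  have hms : MeasurableSet {x : EuclideanSpace ℝ (Fin d) | ‖x‖ ^ 2 = c} :=
    measurableSet_eq_fun (by fun_prop) (by fun_prop)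
  have hdef : multivariateGaussian 0 S = (stdGaussian (EuclideanSpace ℝ (Fin d))).map A := by
    simp [multivariateGaussian, hA]
  -- Otherwise A = 0, the measure is a Dirac mass at 0, and its characteristic function 1
  -- contradicts the choice of t.
  obtain ⟨i, hi⟩ : ∃ i, A (EuclideanSpace.single i 1) ≠ 0 := by
    by_contra! h
    have hA0 : ∀ x, A x = 0 := fun x => by
      rw [← (EuclideanSpace.basisFun (Fin d) ℝ).sum_repr x, map_sum]
      simp [h]
    have h1 := charFun_multivariateGaussian (μ := 0) hS t
    rw [hdef, show (A : EuclideanSpace ℝ (Fin d) → _) = fun _ => 0 from funext hA0,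
      Measure.map_const] at h1
    simp at h1
    have h2 : Real.exp (-(t ⬝ᵥ S *ᵥ t) / 2) = 1 := by
      rw [← Complex.ofReal_inj]
      push_cast
      rw [neg_div]
      exact h1.symm
    rw [Real.exp_eq_one_iff] at h2
    apply ht
    linarith
  obtain ⟨ν, hν, hconv⟩ := stdGaussian_eq_conv i
  have hm : Measurable fun z : ℝ => z • EuclideanSpace.single i (1 : ℝ) := by fun_prop
  have := Measure.isProbabilityMeasure_map (μ := gaussianReal 0 1) hm.aemeasurable
  have hms' : MeasurableSet (A ⁻¹' {x | ‖x‖ ^ 2 = c}) := hms.preimage (by fun_prop)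
  -- By Fubini it suffices to fix y: the line through A y in direction A e_i meets the sphere for
  -- finitely many parameters, and the one-dimensional Gaussian has no atoms.
  rw [hdef, Measure.map_apply (by fun_prop) hms, hconv, Measure.conv,
    Measure.map_apply (by fun_prop) hms', Measure.measure_prod_null (hms'.preimage (by fun_prop))]
  refine ae_of_all _ fun y => ?_
  change (gaussianReal 0 1).map _ _ = 0
  rw [Measure.map_apply hm ((hms'.preimage (by fun_prop)).preimage (by fun_prop))]
  have : NullSingletonClass (gaussianReal 0 1) := nullSingletonClass_gaussianReal one_ne_zero
  refine ((finite_setOf_norm_add_smul_sq_eq (A y) hi c).subset fun z hz => ?_).measure_zero _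
  simpa using hz

end GaussianLimit

/-! ### Second moments and the central limit theorem -/

section Moments

open scoped Matrix

variable {Ω : Type*} [MeasurableSpace Ω] {d : ℕ}

/-- The matrix of second moments of a random vector. -/
noncomputable def secondMoment (P : Measure Ω) (Y : Ω → EuclideanSpace ℝ (Fin d)) :
    Matrix (Fin d) (Fin d) ℝ :=
  .of fun i j => ∫ ω, Y ω i * Y ω j ∂P

lemma inner_sq_eq_sum (x t : EuclideanSpace ℝ (Fin d)) :
    (inner ℝ x t) ^ 2 = ∑ i, ∑ j, t i * t j * (x i * x j) := by
  rw [PiLp.inner_apply, sq, Finset.sum_mul_sum]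
  refine Finset.sum_congr rfl fun i _ => Finset.sum_congr rfl fun j _ => ?_
  simp
  ring

lemma dotProduct_mulVec_self_eq_sum (S : Matrix (Fin d) (Fin d) ℝ) (t : Fin d → ℝ) :
    t ⬝ᵥ S *ᵥ t = ∑ i, ∑ j, t i * t j * S i j := by
  simp only [dotProduct, Matrix.mulVec, Finset.mul_sum]
  refine Finset.sum_congr rfl fun i _ => Finset.sum_congr rfl fun j _ => ?_
  ring

variable {P : Measure Ω} {Y : Ω → EuclideanSpace ℝ (Fin d)}

lemma memLp_two_apply (hY : MemLp Y 2 P) (i : Fin d) : MemLp (fun ω => Y ω i) 2 P :=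
  hY.mono (by have := hY.1; fun_prop) (ae_of_all _ fun ω => PiLp.norm_apply_le (Y ω) i)

lemma secondMoment_dotProduct (hY : MemLp Y 2 P) (t : EuclideanSpace ℝ (Fin d)) :
    t ⬝ᵥ secondMoment P Y *ᵥ t = ∫ ω, (inner ℝ (Y ω) t) ^ 2 ∂P := by
  have hint : ∀ i j, Integrable (fun ω => t i * t j * (Y ω i * Y ω j)) P := fun i j =>
    ((memLp_two_apply hY i).integrable_mul (memLp_two_apply hY j)).const_mul _
  simp_rw [inner_sq_eq_sum]
  rw [dotProduct_mulVec_self_eq_sum,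
    integral_finsetSum _ fun i _ => integrable_finsetSum _ fun j _ => hint i j]
  refine Finset.sum_congr rfl fun i _ => ?_
  rw [integral_finsetSum _ fun j _ => hint i j]
  simp [integral_const_mul, secondMoment]

lemma posSemidef_secondMoment (hY : MemLp Y 2 P) : (secondMoment P Y).PosSemidef := by
  refine .of_dotProduct_mulVec_nonneg ?_ fun t => ?_
  · ext i j
    simp [secondMoment, mul_comm]
  · have := secondMoment_dotProduct hY (WithLp.toLp 2 t)
    rw [star_trivial]
    exact this.symm ▸ integral_nonneg fun ω => sq_nonneg _

/-- Cramér–Wold device: reduces vector limits to the real central limit theorem. -/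
lemma charFun_map_eq_charFun_map_inner {Z : Ω → EuclideanSpace ℝ (Fin d)} (hZ : AEMeasurable Z P)
    (t : EuclideanSpace ℝ (Fin d)) :
    charFun (P.map Z) t = charFun (P.map fun ω => inner ℝ (Z ω) t) 1 := by
  rw [charFun_apply, charFun_apply_real, integral_map hZ (by fun_prop),
    integral_map (by fun_prop) (by fun_prop)]
  simp

/-- The multivariate central limit theorem. -/
lemma tendsto_charFun_inv_sqrt_smul_sum [IsProbabilityMeasure P]
    {X : ℕ → Ω → EuclideanSpace ℝ (Fin d)} (hX_meas : ∀ i, Measurable (X i))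
    (hX_indep : iIndepFun X P) (hX_ident : ∀ i, IdentDistrib (X i) (X 0) P P)
    (hX_sq : MemLp (X 0) 2 P) (hX_mean : ∫ ω, X 0 ω ∂P = 0) (t : EuclideanSpace ℝ (Fin d)) :
    Tendsto (fun n : ℕ => charFun (P.map fun ω => (√n)⁻¹ • ∑ k ∈ Finset.range n, X k ω) t) atTop
      (𝓝 (charFun (multivariateGaussian 0 (secondMoment P (X 0))) t)) := by
  let W : ℕ → Ω → ℝ := fun k ω => inner ℝ (X k ω) t
  have hf : Measurable fun x : EuclideanSpace ℝ (Fin d) => (inner ℝ x t : ℝ) := by fun_prop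
  have hW : MemLp (W 0) 2 P := hX_sq.inner_const t
  have hW0 : ∫ ω, W 0 ω ∂P = 0 := by
    have := integral_inner (𝕜 := ℝ) (hX_sq.integrable (by norm_num)) t
    simp only [W, real_inner_comm t]
    simp [this, hX_mean]
  have hvar : Var[W 0; P] = t ⬝ᵥ secondMoment P (X 0) *ᵥ t := by
    rw [secondMoment_dotProduct hX_sq, variance_of_integral_eq_zero hW.aemeasurable hW0]
  have hclt := (tendstoInDistribution_inv_sqrt_mul_sum_sub (X := W) (Y := id)
    (P' := gaussianReal 0 Var[W 0; P].toNNReal) HasLaw.id hW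
    (hX_indep.comp _ fun _ => hf) fun i => (hX_ident i).comp hf).tendsto
  have h1 := ProbabilityMeasure.tendsto_iff_tendsto_charFun.1 hclt 1
  simp only [ProbabilityMeasure.coe_mk, Measure.map_id, charFun_gaussianReal, hW0] at h1
  rw [charFun_multivariateGaussian (posSemidef_secondMoment hX_sq), ← hvar]
  have hv := variance_nonneg (W 0) P
  convert! h1 using 2 with n
  · rw [charFun_map_eq_charFun_map_inner (by fun_prop)]
    simp [W, inner_smul_left, sum_inner]
  · simp [hv]

end Moments

/-! ### The bootstrap central limit theorem -/

/-- Independence gives a product of n factors; uniformity makes each the same average over the n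
indices. -/
lemma charFun_map_sum_comp_uniform {Ω' E : Type*} [MeasurableSpace Ω'] {P' : Measure Ω'}
    [IsProbabilityMeasure P'] [NormedAddCommGroup E] [InnerProductSpace ℝ E] [MeasurableSpace E]
    [BorelSpace E] [SecondCountableTopology E] [CompleteSpace E]
    {n : ℕ} {J : Fin n → Ω' → Fin n} (hm : ∀ k, Measurable (J k)) (hJ : iIndepFun J P')
    (hu : ∀ k j, P' {ω' | J k ω' = j} = (n : ℝ≥0∞)⁻¹) (g : Fin n → E) (t : E) :
    charFun (P'.map fun ω' => ∑ k, g (J k ω')) t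
      = ((n : ℂ)⁻¹ * ∑ j, Complex.exp (inner ℝ (g j) t * Complex.I)) ^ n := by
  have hg : Measurable g := measurable_of_finite g
  have h := (hJ.comp (fun _ => g) fun _ => hg).charFun_map_fun_sum_eq_prod
    fun k => (hg.comp (hm k)).aemeasurable
  have hk : ∀ k, charFun (P'.map (g ∘ J k)) t
      = (n : ℂ)⁻¹ * ∑ j, Complex.exp (inner ℝ (g j) t * Complex.I) := by
    intro k
    have := Measure.isProbabilityMeasure_map (μ := P') (hm k).aemeasurable
    rw [← Measure.map_map hg (hm k), charFun_apply, integral_map hg.aemeasurable (by fun_prop),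
      integral_fintype (.of_finite), Finset.mul_sum]
    refine Finset.sum_congr rfl fun j _ => ?_
    rw [map_measureReal_apply (hm k) (measurableSet_singleton j), measureReal_def,
      show J k ⁻¹' {j} = {ω' | J k ω' = j} from rfl, hu]
    simp
  have h' := congrFun h t
  simp only [Function.comp_apply] at h'
  rw [h', Finset.prod_apply]
  simp only [Function.comp_def] at hk
  simp [Function.comp_def, hk]

section Statistics

variable {Ω Ω' : Type*} {d : ℕ} (X : ℕ → Ω → EuclideanSpace ℝ (Fin d))

lemma natCast_mul_norm_inv_smul_sq {E : Type*} [NormedAddCommGroup E] [NormedSpace ℝ E] (n : ℕ)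
    (s : E) : n * ‖(n : ℝ)⁻¹ • s‖ ^ 2 = ‖(√n)⁻¹ • s‖ ^ 2 := by
  rw [norm_smul, norm_smul, mul_pow, mul_pow, norm_inv, norm_inv, inv_pow (‖√(n : ℝ)‖),
    Real.norm_of_nonneg (Real.sqrt_nonneg _), Real.sq_sqrt n.cast_nonneg, Real.norm_natCast]
  rcases eq_or_ne (n : ℝ) 0 with h | h
  · simp [h]
  · field_simp

lemma testStat_eq (n : ℕ) (ω : Ω) :
    testStat X n ω = ‖(√n)⁻¹ • ∑ i ∈ Finset.range n, X i ω‖ ^ 2 :=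
  natCast_mul_norm_inv_smul_sq _ _

lemma bootStat_eq (I : (n : ℕ) → Fin n → Ω' → Fin n) (n : ℕ) (ω : Ω) (ω' : Ω') :
    bootStat X I n ω ω' = ‖∑ k, (√n)⁻¹ • (X (I n k ω') ω - sampleMean X n ω)‖ ^ 2 := by
  rw [← Finset.smul_sum]
  exact natCast_mul_norm_inv_smul_sq _ _

/-- The bootstrap central limit theorem at a fixed sample point. -/
lemma tendsto_charFun_bootstrap [MeasurableSpace Ω'] {P' : Measure Ω'} [IsProbabilityMeasure P']
    {I : (n : ℕ) → Fin n → Ω' → Fin n} (hI : IsResampling P' I) {ω : Ω}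
    {t : EuclideanSpace ℝ (Fin d)} {q : ℝ}
    (h1 : Tendsto (fun n : ℕ => (n : ℝ)⁻¹ * ∑ j ∈ Finset.range n, inner ℝ (X j ω) t)
      atTop (𝓝 0))
    (h2 : Tendsto (fun n : ℕ => (n : ℝ)⁻¹ * ∑ j ∈ Finset.range n, (inner ℝ (X j ω) t) ^ 2)
      atTop (𝓝 q)) :
    Tendsto (fun n : ℕ => charFun
      (P'.map fun ω' => ∑ k, (√n)⁻¹ • (X (I n k ω') ω - sampleMean X n ω)) t) atTop
      (𝓝 (Complex.exp (-q / 2))) := by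
  refine (tendsto_empirical_charFun_pow h1 h2).congr fun n => ?_
  rw [charFun_map_sum_comp_uniform (hI.measurable n) (hI.indep n) (hI.uniform n)
    (fun j => (√n)⁻¹ • (X j ω - sampleMean X n ω)), Finset.sum_range]
  simp only [sampleMean, inner_smul_left, inner_sub_left, sum_inner]
  simp

end Statistics

/-! ### Strong laws and the degenerate case -/

section StrongLaw

open scoped Matrix

variable {Ω : Type*} [MeasurableSpace Ω] {P : Measure Ω} {d : ℕ}
  {X : ℕ → Ω → EuclideanSpace ℝ (Fin d)}

/-- Almost surely, the first two empirical moments converge in all directions. -/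
lemma ae_tendsto_empirical_moments [IsProbabilityMeasure P] (hX_indep : iIndepFun X P)
    (hX_ident : ∀ i, IdentDistrib (X i) (X 0) P P) (hX_sq : MemLp (X 0) 2 P)
    (hX_mean : ∫ ω, X 0 ω ∂P = 0) :
    ∀ᵐ ω ∂P, ∀ t : EuclideanSpace ℝ (Fin d),
      Tendsto (fun n : ℕ => (n : ℝ)⁻¹ * ∑ j ∈ Finset.range n, inner ℝ (X j ω) t) atTop (𝓝 0) ∧
      Tendsto (fun n : ℕ => (n : ℝ)⁻¹ * ∑ j ∈ Finset.range n, (inner ℝ (X j ω) t) ^ 2) atTop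
        (𝓝 (t ⬝ᵥ secondMoment P (X 0) *ᵥ t)) := by
  have h1 := strong_law_ae X (hX_sq.integrable (by norm_num))
    (fun i j hij => hX_indep.indepFun hij) hX_ident
  -- Only finitely many coordinate products are needed, so a single null set serves all t.
  have h2 : ∀ᵐ ω ∂P, ∀ i j, Tendsto
      (fun n : ℕ => (∑ k ∈ Finset.range n, X k ω i * X k ω j) / n) atTop
      (𝓝 (secondMoment P (X 0) i j)) := by
    refine ae_all_iff.2 fun i => ae_all_iff.2 fun j => ?_
    have hf : Measurable fun x : EuclideanSpace ℝ (Fin d) => x i * x j := by fun_prop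
    exact strong_law_ae_real (fun k ω => X k ω i * X k ω j)
      ((memLp_two_apply hX_sq i).integrable_mul (memLp_two_apply hX_sq j))
      (fun k l hkl => (hX_indep.indepFun hkl).comp hf hf) fun k => (hX_ident k).comp hf
  filter_upwards [h1, h2] with ω h1 h2 t
  constructor
  · have := Filter.Tendsto.inner (𝕜 := ℝ) h1 (tendsto_const_nhds (x := t))
    simpa [hX_mean, inner_smul_left, sum_inner] using this
  · have : Tendsto (fun n : ℕ => ∑ i, ∑ j, t i * t j *
        ((∑ k ∈ Finset.range n, X k ω i * X k ω j) / n)) atTop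
        (𝓝 (∑ i, ∑ j, t i * t j * secondMoment P (X 0) i j)) :=
      tendsto_finsetSum _ fun i _ => tendsto_finsetSum _ fun j _ => (h2 i j).const_mul _
    rw [dotProduct_mulVec_self_eq_sum]
    refine this.congr fun n => ?_
    simp_rw [inner_sq_eq_sum, div_eq_inv_mul, Finset.mul_sum]
    rw [Finset.sum_comm_cycle]
    refine Finset.sum_congr rfl fun k _ => Finset.sum_congr rfl fun i _ =>
      Finset.sum_congr rfl fun j _ => ?_
    ring

/-- Taking t to be each basis vector shows that every coordinate has zero second moment. -/
lemma ae_eq_zero_of_secondMoment_dotProduct {Y : Ω → EuclideanSpace ℝ (Fin d)} (hY : MemLp Y 2 P)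
    (h : ∀ t : EuclideanSpace ℝ (Fin d), t ⬝ᵥ secondMoment P Y *ᵥ t = 0) : ∀ᵐ ω ∂P, Y ω = 0 := by
  have : ∀ᵐ ω ∂P, ∀ i, Y ω i = 0 := by
    refine ae_all_iff.2 fun i => ?_
    have hi := h (EuclideanSpace.single i 1)
    rw [secondMoment_dotProduct hY, integral_eq_zero_iff_of_nonneg (fun ω => sq_nonneg _)
      (hY.inner_const _).integrable_sq] at hi
    filter_upwards [hi] with ω hω
    simpa [EuclideanSpace.inner_single_right] using hω
  filter_upwards [this] with ω hω
  ext i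
  exact hω i

end StrongLaw

end BootstrapMean

/-! ### The main theorem -/

theorem mainTheorem8 {Ω Ω' : Type*} [MeasurableSpace Ω] [MeasurableSpace Ω']
    (P : Measure Ω) [IsProbabilityMeasure P] (P' : Measure Ω') [IsProbabilityMeasure P']
    (d : ℕ) (X : ℕ → Ω → EuclideanSpace ℝ (Fin d))
    (hX_meas : ∀ i, Measurable (X i))
    (hX_indep : iIndepFun X P)
    (hX_ident : ∀ i, IdentDistrib (X i) (X 0) P P)
    (hX_sq : Integrable (fun ω => ‖X 0 ω‖ ^ 2) P)
    (hX_mean : ∫ ω, X 0 ω ∂P = 0)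
    (I : (n : ℕ) → Fin n → Ω' → Fin n)
    (hI : BootstrapMean.IsResampling P' I) :
    ∀ᵐ ω ∂P, Tendsto
      (fun n : ℕ => ⨆ x : ℝ,
        |P'.real {ω' | BootstrapMean.bootStat X I n ω ω' ≤ x}
          - P.real {η | BootstrapMean.testStat X n η ≤ x}|)
      atTop (𝓝 0) := by
  open BootstrapMean in
  open scoped Matrix in
  have hL2 : MemLp (X 0) 2 P :=
    (memLp_two_iff_integrable_sq_norm (hX_meas 0).aestronglyMeasurable).2 hX_sq
  by_cases hS : ∃ t : EuclideanSpace ℝ (Fin d), t ⬝ᵥ secondMoment P (X 0) *ᵥ t ≠ 0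
  · have hPSD := posSemidef_secondMoment hL2
    have hZ : ∀ n : ℕ, Measurable fun η => (√n)⁻¹ • ∑ i ∈ Finset.range n, X i η := fun n => by
      fun_prop
    let ρ : ProbabilityMeasure (EuclideanSpace ℝ (Fin d)) :=
      ⟨multivariateGaussian 0 (secondMoment P (X 0)), inferInstance⟩
    let ν : ℕ → ProbabilityMeasure (EuclideanSpace ℝ (Fin d)) := fun n =>
      ⟨P.map fun η => (√n)⁻¹ • ∑ i ∈ Finset.range n, X i η,
        Measure.isProbabilityMeasure_map (hZ n).aemeasurable⟩
    have hν : Tendsto ν atTop (𝓝 ρ) := ProbabilityMeasure.tendsto_iff_tendsto_charFun.2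
      (tendsto_charFun_inv_sqrt_smul_sum hX_meas hX_indep hX_ident hL2 hX_mean)
    have hms : ∀ x : ℝ, MeasurableSet {w : EuclideanSpace ℝ (Fin d) | ‖w‖ ^ 2 ≤ x} := fun x =>
      measurableSet_le (by fun_prop) measurable_const
    filter_upwards [ae_tendsto_empirical_moments hX_indep hX_ident hL2 hX_mean] with ω hω
    have hB : ∀ n : ℕ, Measurable fun ω' =>
        ∑ k, (√n)⁻¹ • (X (I n k ω') ω - sampleMean X n ω) := fun n =>
      Finset.measurable_sum _ fun k _ => (measurable_of_finite fun j : Fin n =>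
        (√n)⁻¹ • (X j ω - sampleMean X n ω)).comp (hI.measurable n k)
    let μ : ℕ → ProbabilityMeasure (EuclideanSpace ℝ (Fin d)) := fun n =>
      ⟨P'.map fun ω' => ∑ k, (√n)⁻¹ • (X (I n k ω') ω - sampleMean X n ω),
        Measure.isProbabilityMeasure_map (hB n).aemeasurable⟩
    have hμ : Tendsto μ atTop (𝓝 ρ) := by
      refine ProbabilityMeasure.tendsto_iff_tendsto_charFun.2 fun t => ?_
      have h := tendsto_charFun_bootstrap X hI (hω t).1 (hω t).2
      convert! h using 2
      rw [ProbabilityMeasure.coe_mk, charFun_multivariateGaussian hPSD]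
      simp [neg_div]
    refine (tendsto_iSup_abs_sub_of_tendsto hμ hν
      (multivariateGaussian_norm_sq_eq_null hPSD hS)).congr fun n => ?_
    refine iSup_congr fun x => ?_
    simp only [μ, ν, ProbabilityMeasure.coe_mk]
    rw [map_measureReal_apply (hB n) (hms x), map_measureReal_apply (hZ n) (hms x)]
    simp only [bootStat_eq, testStat_eq]
    rfl
  -- Degenerate case, which includes d = 0: both distribution functions are the indicator of [0, ∞).
  · push Not at hS
    have h0 : ∀ᵐ ω ∂P, ∀ i, X i ω = 0 := ae_all_iff.2 fun i =>
      (hX_ident i).symm.ae_mem_snd (measurableSet_singleton 0)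
        (ae_eq_zero_of_secondMoment_dotProduct hL2 hS)
    filter_upwards [h0] with ω hω
    refine tendsto_const_nhds.congr fun n => ?_
    have h1 : ∀ x : ℝ, P'.real {ω' | bootStat X I n ω ω' ≤ x}
        = P.real {η | testStat X n η ≤ x} := fun x => by
      have h2 : P.real {η | testStat X n η ≤ x} = P.real {_η : Ω | 0 ≤ x} := by
        refine measureReal_congr ?_
        filter_upwards [h0] with η hη
        refine propext ?_
        change testStat X n η ≤ x ↔ 0 ≤ x
        simp [testStat, sampleMean, hη]
      rw [h2]
      by_cases hx : 0 ≤ x <;> simp [bootStat_eq, sampleMean, hω, hx]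
    simp [h1]
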